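/- Let $d\ge 2$, and let $\mathbf g$ be a standard Gaussian random vector in $\mathbb R^d$. For a closed convex cone $C\subseteq\mathbb R^d$ with apex $o$, let $C^\circ=\{x:\langle x,y\rangle\le 0\text{ for all }y\in C\}$ be its dual cone and let $\Pi_C$ be the nearest point map onto $C$. Let $\widehat{\mathcal B}(\mathbb R^d\times\mathbb R^d)$ be the $\sigma$-algebra of all Borel sets $\eta\subseteq\mathbb R^d\times\mathbb R^d$ such that $(\lambda x,\mu y)\in\eta$ whenever $(x,y)\in\eta$ and $\lambda,\mu>0$. For a polyhedral cone $C$ and $k\in\{0,\dots,d\}$ let $\mathrm{skel}_k C$ be the union of the relative interiors of the $k$-dimensional faces of $C$, and let $$\Omega_k(C,\eta)=\mathbb P\{\Pi_C(\mathbf g)\in \mathrm{skel}_kC,\ (\Pi_C(\mathbf g),\Pi_{C^\circ}(\mathbf g))\in\eta\},\qquad \eta\in\widehat{\mathcal B}(\mathbb R^d\times\mathbb R^d).$$ For a Borel measurable function $f:[0,\infty)^2\to[0,\infty)$ let $$\varphi_f(C,\eta)=\mathbb E\left[f(\|\Pi_C(\mathbf g)\|^2,\|\Pi_{C^\circ}(\mathbf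 g)\|^2)\,\mathbf 1_\eta(\Pi_C(\mathbf g),\Pi_{C^\circ}(\mathbf g))\right]\in[0,\infty].$$ **Theorem 3.1.** Let $C\subseteq\mathbb R^d$ be a polyhedral cone, and let $f:[0,\infty)^2\to[0,\infty)$ be a Borel measurable function such that $\varphi_f(C,\eta)$ is finite for all $\eta\in\widehat{\mathcal B}(\mathbb R^d\times\mathbb R^d)$. Then $$\varphi_f(C,\eta)=\sum_{k=0}^d I_k(f)\,\Omega_k(C,\eta)\qquad\text{for all }\eta\in\widehat{\mathcal B}(\mathbb R^d\times\mathbb R^d),$$ where the coefficients $I_k(f)\in[0,\infty]$ (with the convention $\infty\cdot 0=0$) are given by $$I_k(f)=\varphi_f(L_k,\mathbb R^d\times\mathbb R^d)$$ with an arbitrary $k$-dimensional linear subspace $L_k$ of $\mathbb R^d$. Explicitly, with $\omega_n=2\pi^{n/2}/\Gamma(n/2)$, $$I_k(f)=\frac{\omega_k\omega_{d-k}}{\sqrt{2\pi}^{\,d}}\int_0^\infty\int_0^\infty f(r^2,s^2)\,e^{-\frac12(r^2+s^2)}\,r^{k-1}s^{d-k-1}\,\mathrm ds\,\mathrm dr$$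 for $k=1,\dots,d-1$, and $$I_0(f)=\frac{\omega_d}{\sqrt{2\pi}^{\,d}}\int_0^\infty f(0,s^2)\,e^{-\frac12 s^2}s^{d-1}\,\mathrm ds,\qquad I_d(f)=\frac{\omega_d}{\sqrt{2\pi}^{\,d}}\int_0^\infty f(r^2,0)\,e^{-\frac12 r^2}r^{d-1}\,\mathrm dr.$$ -/

import Mathlib

open MeasureTheory ProbabilityTheory Set
open scoped ENNReal NNReal

noncomputable section

namespace ConicSupport

/-- The space `ℝ^d` with its Euclidean norm and inner product. -/
abbrev E (d : ℕ) : Type := EuclideanSpace ℝ (Fin d)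

/-- The dual (polar) cone `C° = {x : ⟪x, y⟫ ≤ 0 for all y ∈ C}`; see `mem_polar`. Mathlib's
`ProperCone` is the type of closed convex cones with apex `0`. -/
def polar {d : ℕ} (C : ProperCone ℝ (E d)) : ProperCone ℝ (E d) :=
  ProperCone.innerDual (-(C : Set (E d)))

theorem mem_polar {d : ℕ} (C : ProperCone ℝ (E d)) (x : E d) :
    x ∈ polar C ↔ ∀ y ∈ C, inner ℝ x y ≤ 0 := by
  unfold polar
  rw [ProperCone.mem_innerDual]
  constructor
  · intro h y hy
    have h1 := h (x := -y) (by simpa using hy)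
    rw [inner_neg_left, real_inner_comm] at h1
    linarith
  · intro h y hy
    have h1 := h (-y) (by simpa using hy)
    rw [inner_neg_right, real_inner_comm] at h1
    linarith

/-- A polyhedral cone: an intersection of finitely many closed half-spaces with `0` on the
boundary (the whole space is the empty intersection). -/
def IsPolyhedral {d : ℕ} (C : ProperCone ℝ (E d)) : Prop :=
  ∃ s : Finset (E d), ∀ x : E d, x ∈ C ↔ ∀ a ∈ s, inner ℝ a x ≤ 0

/-- A linear subspace as a closed convex cone. -/
def subspaceCone {d : ℕ} (L : Submodule ℝ (E d)) : ProperCone ℝ (E d) :=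
  { toSubmodule := PointedCone.ofSubmodule L
    isClosed' := L.closed_of_finiteDimensional }

theorem mem_subspaceCone {d : ℕ} (L : Submodule ℝ (E d)) (x : E d) :
    x ∈ subspaceCone L ↔ x ∈ L := Iff.rfl

theorem exists_nearest {d : ℕ} (C : ProperCone ℝ (E d)) (x : E d) :
    ∃ p ∈ C, ∀ y ∈ C, ‖x - p‖ ≤ ‖x - y‖ := by
  obtain ⟨p, hp, -, h⟩ := C.isClosed.exists_infDist_eq_dist C.nonempty x |>.imp
    fun p h => And.intro h.1 (And.intro trivial h.2)
  refine ⟨p, hp, fun y hy => ?_⟩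
  rw [← dist_eq_norm, ← dist_eq_norm, ← h]
  exact Metric.infDist_le_dist_of_mem hy

/-- The nearest point map `Π_C` of a closed convex cone. -/
def proj {d : ℕ} (C : ProperCone ℝ (E d)) (x : E d) : E d :=
  (exists_nearest C x).choose

theorem proj_mem {d : ℕ} (C : ProperCone ℝ (E d)) (x : E d) : proj C x ∈ C :=
  (exists_nearest C x).choose_spec.1

theorem norm_sub_proj_le {d : ℕ} (C : ProperCone ℝ (E d)) (x y : E d) (hy : y ∈ C) :
    ‖x - proj C x‖ ≤ ‖x - y‖ :=
  (exists_nearest C x).choose_spec.2 y hy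

/-- The nearest point is unique. -/
theorem eq_proj_of_nearest {d : ℕ} (C : ProperCone ℝ (E d)) (x p : E d) (hp : p ∈ C)
    (h : ∀ y ∈ C, ‖x - p‖ ≤ ‖x - y‖) : p = proj C x := by
  set q := proj C x with hq
  have hqC : q ∈ C := proj_mem C x
  have hpq : ‖x - p‖ = ‖x - q‖ := le_antisymm (h q hqC) (norm_sub_proj_le C x p hp)
  have hm : (1 / 2 : ℝ) • p + (1 / 2 : ℝ) • q ∈ (C : Set (E d)) :=
    C.toPointedCone.add_mem (C.smul_mem hp (by norm_num)) (C.smul_mem hqC (by norm_num))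
  have h1 := h _ hm
  have hpar := parallelogram_law_with_norm ℝ (x - p) (x - q)
  have e1 : x - p + (x - q) = (2 : ℝ) • (x - ((1 / 2 : ℝ) • p + (1 / 2 : ℝ) • q)) := by
    module
  have e2 : x - p - (x - q) = q - p := by abel
  rw [e1, e2, norm_smul, ← hpq] at hpar
  norm_num at hpar
  have h0 : ‖q - p‖ = 0 := by
    nlinarith [norm_nonneg (q - p), norm_nonneg (x - p),
      norm_nonneg (x - ((1 / 2 : ℝ) • p + (1 / 2 : ℝ) • q))]
  exact (sub_eq_zero.mp (norm_eq_zero.mp h0)).symm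

/-- The `k`-skeleton of `C`: the union of the relative interiors of the `k`-dimensional faces.
Every nonempty face of a convex cone is itself a convex cone containing `0`, so faces are taken
among pointed cones, and the dimension of a face is that of its linear span. -/
def skel {d : ℕ} (k : ℕ) (C : ProperCone ℝ (E d)) : Set (E d) :=
  {x | ∃ F : PointedCone ℝ (E d), F.IsFaceOf C.toPointedCone ∧
    Module.finrank ℝ (Submodule.span ℝ (F : Set (E d))) = k ∧
    x ∈ intrinsicInterior ℝ (F : Set (E d))}

/-- Membership in the biconic `σ`-algebra of `ℝ^d × ℝ^d`. -/
def IsBiconic {d : ℕ} (η : Set (E d × E d)) : Prop :=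
  MeasurableSet η ∧
    ∀ p ∈ η, ∀ a b : ℝ, 0 < a → 0 < b → (a • p.1, b • p.2) ∈ η

/-- The conic support measure `Ω_k(C, η)`: the probability that the projection of a standard
Gaussian vector `g` lies in the `k`-skeleton and that `(Π_C(g), Π_{C°}(g)) ∈ η`. -/
def supportMeasure {d : ℕ} (k : ℕ) (C : ProperCone ℝ (E d)) (η : Set (E d × E d)) : ℝ≥0∞ :=
  stdGaussian (E d) {g | proj C g ∈ skel k C ∧ (proj C g, proj (polar C) g) ∈ η}

/-- `φ_f(C, η) = 𝔼[f(‖Π_C(g)‖², ‖Π_{C°}(g)‖²) 1_η(Π_C(g), Π_{C°}(g))]`, with values in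
`[0, ∞]`. -/
def phi {d : ℕ} (f : ℝ≥0 × ℝ≥0 → ℝ≥0) (C : ProperCone ℝ (E d)) (η : Set (E d × E d)) : ℝ≥0∞ :=
  ∫⁻ g, (f (‖proj C g‖₊ ^ 2, ‖proj (polar C) g‖₊ ^ 2) : ℝ≥0∞) *
    η.indicator (fun _ => (1 : ℝ≥0∞)) (proj C g, proj (polar C) g) ∂(stdGaussian (E d))

/-- `ω_n = 2 π^{n/2} / Γ(n/2)`, the surface area of the unit sphere in `ℝ^n`, `n ≥ 1`. -/
def omega (n : ℕ) : ℝ := 2 * Real.pi ^ ((n : ℝ) / 2) / Real.Gamma ((n : ℝ) / 2)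

/-- The coefficients `I_k(f)`, `0 ≤ k ≤ d`, with values in `[0, ∞]`, given by their explicit
integral expressions. -/
def coeffI (d : ℕ) (f : ℝ≥0 × ℝ≥0 → ℝ≥0) (k : ℕ) : ℝ≥0∞ :=
  if k = 0 then
    ENNReal.ofReal (omega d / √(2 * Real.pi) ^ d) *
      ∫⁻ s in Ioi (0 : ℝ), (f (0, Real.toNNReal (s ^ 2)) : ℝ≥0∞) *
        ENNReal.ofReal (Real.exp (-(1 / 2) * s ^ 2) * s ^ (d - 1))
  else if k = d then
    ENNReal.ofReal (omega d / √(2 * Real.pi) ^ d) *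
      ∫⁻ r in Ioi (0 : ℝ), (f (Real.toNNReal (r ^ 2), 0) : ℝ≥0∞) *
        ENNReal.ofReal (Real.exp (-(1 / 2) * r ^ 2) * r ^ (d - 1))
  else
    ENNReal.ofReal (omega k * omega (d - k) / √(2 * Real.pi) ^ d) *
      ∫⁻ r in Ioi (0 : ℝ), ∫⁻ s in Ioi (0 : ℝ),
        (f (Real.toNNReal (r ^ 2), Real.toNNReal (s ^ 2)) : ℝ≥0∞) *
          ENNReal.ofReal (Real.exp (-(1 / 2) * (r ^ 2 + s ^ 2)) *
            r ^ (k - 1) * s ^ (d - k - 1))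

end ConicSupport

end

/-! Write C as a finite intersection of half-spaces with normals in `s`, and sort points of C by the
set I ⊆ `s` of constraints active there. These strata are the relative interiors of faces, and the
face of I, when its stratum is nonempty, spans the common kernel L of I. If Π_C(g) lies in the
stratum of I, then near that point C contains all of L, so the residual is orthogonal to L; hence
Π_C(g) and Π_{C°}(g) are the orthogonal projections of g to L and Lᗮ
(`proj_eq_of_proj_mem_stratum`).

On each stratum the nonlinear projections thus become linear ones, and the event is a biconic
condition on the two components. These are independent Gaussians, each with norm independent of
direction, so the expectation factors into a mean depending on the norms alone times the probability
of the event (`lintegral_norms_mul_indicator_biconic`). By polar coordinates the mean depends on L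
only through its dimension and equals I_k(f) (`subspaceMean_eq_coeffI`). Summing over the strata and
grouping them by dimension gives the formula; finite sums in [0, ∞] need no subtraction. -/

noncomputable section

namespace ConicSupport

/-! ### Standard Gaussian measure: density, orthogonal splitting, polar coordinates. -/

section Gaussian

variable {V : Type*} [NormedAddCommGroup V] [InnerProductSpace ℝ V] [FiniteDimensional ℝ V]
  [MeasurableSpace V] [BorelSpace V]

/-- Both sides are finite measures with the same characteristic function, by the Fourier transform
of the Gaussian. -/
theorem stdGaussian_eq_withDensity :
    stdGaussian V = (volume : Measure V).withDensity fun x => ENNReal.ofReal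
      ((√(2 * Real.pi) ^ Module.finrank ℝ V)⁻¹ * Real.exp (-(1 / 2) * ‖x‖ ^ 2)) := by
  set n := Module.finrank ℝ V with hn
  set c : ℝ := (√(2 * Real.pi) ^ n)⁻¹ with hc
  have hc0 : 0 ≤ c := by positivity
  have hint : Integrable (fun x : V => c * Real.exp (-(1 / 2) * ‖x‖ ^ 2)) volume := by
    have h := (GaussianFourier.integrable_cexp_neg_mul_sq_norm_add (V := V) (b := (1 / 2 : ℂ))
      (by norm_num) 0 0).norm
    refine (h.congr (.of_forall fun x => ?_)).const_mul c
    simp only [Complex.norm_exp]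
    congr 1
    simp [← Complex.ofReal_pow]
  have hfin : IsFiniteMeasure ((volume : Measure V).withDensity fun x => ENNReal.ofReal
      (c * Real.exp (-(1 / 2) * ‖x‖ ^ 2))) :=
    isFiniteMeasure_withDensity_ofReal hint.2
  apply Measure.ext_of_charFun
  ext t
  rw [charFun_stdGaussian, charFun_apply, integral_withDensity_eq_integral_toReal_smul
    (by fun_prop) (by simp)]
  have key := GaussianFourier.integral_cexp_neg_mul_sq_norm_add (V := V) (b := (1 / 2 : ℂ))
      (by norm_num) Complex.I t
  have hcc : ((Real.pi : ℂ) / (1 / 2)) ^ ((n : ℂ) / 2) = ((c⁻¹ : ℝ) : ℂ) := by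
    have h2 : ((Real.pi : ℂ) / (1 / 2)) = ((2 * Real.pi : ℝ) : ℂ) := by push_cast; ring
    have h3 : ((n : ℂ) / 2) = ((n / 2 : ℝ) : ℂ) := by push_cast; ring
    rw [h2, h3, ← Complex.ofReal_cpow (by positivity), hc, inv_inv, Real.sqrt_eq_rpow,
      ← Real.rpow_natCast, ← Real.rpow_mul (by positivity)]
    congr 2; ring
  rw [← hn, hcc] at key
  have hcne : (c : ℂ) ≠ 0 := by
    rw [Complex.ofReal_ne_zero, hc]; positivity
  clear_value c
  calc Complex.exp (-‖t‖ ^ 2 / 2)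
      = c * ∫ v : V, Complex.exp (-(1 / 2) * ‖v‖ ^ 2 + Complex.I * inner ℝ t v) := by
        rw [key, ← mul_assoc, Complex.ofReal_inv, mul_inv_cancel₀ hcne, one_mul]
        congr 1
        rw [Complex.I_sq]; ring
    _ = _ := by
        rw [← integral_const_mul]
        congr 1
        ext v
        rw [ENNReal.toReal_ofReal (by positivity), Complex.exp_add, real_inner_comm, Complex.real_smul]
        push_cast
        rw [mul_comm Complex.I]
        ring

/-- The standard Gaussian measure is the product of its marginals on a subspace and on the
orthogonal complement of that subspace. -/
theorem map_add_stdGaussian_prod (L : Submodule ℝ V) :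
    ((stdGaussian L).prod (stdGaussian Lᗮ)).map (fun p => (p.1 : V) + (p.2 : V)) =
      stdGaussian V := by
  -- A marginal sees `t` only through its projection to `K`; Pythagoras then recombines the two
  -- exponents.
  have hsub : ∀ (K : Submodule ℝ V) (t : V),
      charFun ((stdGaussian K).map (Subtype.val : K → V)) t =
        Complex.exp (-‖K.starProjection t‖ ^ 2 / 2) := by
    intro K t
    have h := charFun_stdGaussian (E := K) (K.orthogonalProjectionOnto t)
    rw [charFun_apply] at h
    rw [charFun_apply, integral_map (by fun_prop) (by fun_prop)]
    rw [Submodule.starProjection_apply, Submodule.norm_coe, ← h]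
    congr 1
    ext x
    rw [Submodule.inner_orthogonalProjectionOnto_eq_of_mem_left]
  have : IsProbabilityMeasure ((stdGaussian L).map (Subtype.val : L → V)) :=
    Measure.isProbabilityMeasure_map (by fun_prop)
  have : IsProbabilityMeasure ((stdGaussian Lᗮ).map (Subtype.val : Lᗮ → V)) :=
    Measure.isProbabilityMeasure_map (by fun_prop)
  have hmap : ((stdGaussian L).prod (stdGaussian Lᗮ)).map (fun p => (p.1 : V) + (p.2 : V)) =
      (((stdGaussian L).map (Subtype.val : L → V)).prod
        ((stdGaussian Lᗮ).map (Subtype.val : Lᗮ → V))).map (fun p => p.1 + p.2) := by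
    rw [Measure.map_prod_map _ _ (by fun_prop) (by fun_prop),
      Measure.map_map (by fun_prop) (by fun_prop)]
    rfl
  rw [hmap]
  apply Measure.ext_of_charFun
  rw [charFun_map_add_prod_eq_mul]
  ext t
  rw [Pi.mul_apply, hsub, hsub, charFun_stdGaussian, ← Complex.exp_add]
  congr 1
  have h := Submodule.norm_sq_eq_add_norm_sq_starProjection t L
  rw [show (‖t‖ : ℂ) ^ 2 = ((‖t‖ ^ 2 : ℝ) : ℂ) by push_cast; rfl, h]
  push_cast
  ring

theorem lintegral_stdGaussian_starProjection (L : Submodule ℝ V) {g : V × V → ℝ≥0∞}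
    (hg : Measurable g) :
    ∫⁻ x, g (L.starProjection x, Lᗮ.starProjection x) ∂stdGaussian V =
      ∫⁻ a, ∫⁻ b, g ((a : V), (b : V)) ∂stdGaussian Lᗮ ∂stdGaussian L := by
  rw [← map_add_stdGaussian_prod L, lintegral_map (by fun_prop) (by fun_prop),
    lintegral_prod _ (by fun_prop)]
  refine lintegral_congr fun a => lintegral_congr fun b => ?_
  rw [map_add, map_add, Submodule.starProjection_eq_self_iff.2 a.2,
    Submodule.starProjection_eq_self_iff.2 b.2,
    (Submodule.starProjection_apply_eq_zero_iff L).2 b.2,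
    (Submodule.starProjection_apply_eq_zero_iff Lᗮ).2 (Submodule.le_orthogonal_orthogonal L a.2)]
  simp

/-- The origin is a null set, and off it Lebesgue measure is the product of the sphere measure with
r^(n-1) dr. -/
theorem lintegral_stdGaussian_polar [Nontrivial V] {g : V → ℝ≥0∞} (hg : Measurable g) :
    ∫⁻ x, g x ∂stdGaussian V =
      ∫⁻ u, (∫⁻ r in Ioi (0 : ℝ), g (r • (u : V)) *
        ENNReal.ofReal ((√(2 * Real.pi) ^ Module.finrank ℝ V)⁻¹ *
          (Real.exp (-(1 / 2) * r ^ 2) * r ^ (Module.finrank ℝ V - 1))))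
        ∂(volume : Measure V).toSphere := by
  set n := Module.finrank ℝ V with hn
  set w : V → ℝ≥0∞ := fun x => ENNReal.ofReal
      ((√(2 * Real.pi) ^ n)⁻¹ * Real.exp (-(1 / 2) * ‖x‖ ^ 2)) with hw
  have hwm : Measurable w := by fun_prop
  have hmp := (volume : Measure V).measurePreserving_homeomorphUnitSphereProd
  rw [stdGaussian_eq_withDensity, lintegral_withDensity_eq_lintegral_mul _ hwm hg,
    show ∫⁻ x, (w * g) x ∂(volume : Measure V) = ∫⁻ x in {0}ᶜ, (w * g) x by
      rw [restrict_compl_singleton],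
    ← lintegral_subtype_comap (measurableSet_singleton _).compl]
  have h1 := (hmp.symm (homeomorphUnitSphereProd V).toMeasurableEquiv).lintegral_comp
    (f := fun x => (w * g) (x : V)) (by fun_prop)
  rw [← h1, lintegral_prod _ (by fun_prop)]
  refine lintegral_congr fun u => ?_
  have hu : ‖(u : V)‖ = 1 := by simp
  rw [Measure.volumeIoiPow, lintegral_withDensity_eq_lintegral_mul _ (by fun_prop) (by fun_prop),
    ← lintegral_subtype_comap measurableSet_Ioi]
  refine lintegral_congr fun r => ?_
  have hr : (0 : ℝ) < r := r.2
  have hval : ((homeomorphUnitSphereProd V).toMeasurableEquiv.symm (u, r) : V)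
      = (r : ℝ) • (u : V) := by
    exact homeomorphUnitSphereProd_symm_apply_coe V (u, r)
  simp only [Pi.mul_apply, hval, hw, norm_smul, hu, mul_one, Real.norm_eq_abs, sq_abs]
  rw [mul_comm, mul_right_comm, mul_comm _ (g _), ← ENNReal.ofReal_mul (by positivity), mul_assoc]

/-- The norm and the direction of a standard Gaussian vector are independent. -/
theorem lintegral_norm_mul_indicator_conic {h : ℝ → ℝ≥0∞} (hh : Measurable h) {A : Set V}
    (hA : MeasurableSet A) (hcon : ∀ x ∈ A, ∀ a : ℝ, 0 < a → a • x ∈ A) :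
    ∫⁻ x, h ‖x‖ * A.indicator (fun _ => 1) x ∂stdGaussian V =
      (∫⁻ x, h ‖x‖ ∂stdGaussian V) * stdGaussian V A := by
  -- The zero space must be covered, since L or Lᗮ may be trivial; polar coordinates are unavailable
  -- there.
  rcases subsingleton_or_nontrivial V with hV | hV
  · have h0 : ∀ x : V, ‖x‖ = 0 := fun x => by rw [Subsingleton.elim x 0, norm_zero]
    simp only [h0]
    rw [lintegral_const_mul _ (by fun_prop (disch := exact hA)), lintegral_indicator_const hA]
    simp
  set w : ℝ → ℝ≥0∞ := fun r => ENNReal.ofReal ((√(2 * Real.pi) ^ Module.finrank ℝ V)⁻¹ *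
          (Real.exp (-(1 / 2) * r ^ 2) * r ^ (Module.finrank ℝ V - 1))) with hw
  have hwm : Measurable w := by fun_prop
  -- Membership in a conic set depends on the direction only, so the integral is a radial factor
  -- times a spherical one.
  have hsplit : ∀ {g : ℝ → ℝ≥0∞} (_ : Measurable g) {B : Set V} (_ : MeasurableSet B)
      (_ : ∀ x ∈ B, ∀ a : ℝ, 0 < a → a • x ∈ B),
      ∫⁻ x, g ‖x‖ * B.indicator (fun _ => 1) x ∂stdGaussian V =
        (∫⁻ r in Ioi (0 : ℝ), g r * w r) *
          (volume : Measure V).toSphere ((↑) ⁻¹' B) := by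
    intro g hg B hB hcB
    rw [lintegral_stdGaussian_polar (by fun_prop (disch := exact hB))]
    have hin : ∀ u : Metric.sphere (0 : V) 1,
        ∫⁻ r in Ioi (0 : ℝ), (g ‖r • (u : V)‖ * B.indicator (fun _ => 1) (r • (u : V))) * w r =
          (∫⁻ r in Ioi (0 : ℝ), g r * w r) *
            (((↑) ⁻¹' B : Set (Metric.sphere (0 : V) 1)).indicator (fun _ => 1) u) := by
      intro u
      rw [← lintegral_mul_const _ (by fun_prop)]
      refine setLIntegral_congr_fun measurableSet_Ioi fun r hr => ?_
      have hr : 0 < r := hr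
      have hiff : r • (u : V) ∈ B ↔ (u : V) ∈ B := by
        refine ⟨fun hx => ?_, fun hx => hcB _ hx r hr⟩
        have := hcB _ hx r⁻¹ (by positivity)
        rwa [smul_smul, inv_mul_cancel₀ hr.ne', one_smul] at this
      have hnorm : ‖r • (u : V)‖ = r := by simp [norm_smul, abs_of_pos hr]
      by_cases hx : (u : V) ∈ B
      · simp [hnorm, hx, hiff]
      · simp [hx, hiff]
    refine (lintegral_congr hin).trans ?_
    have hBs : MeasurableSet ((↑) ⁻¹' B : Set (Metric.sphere (0 : V) 1)) :=
      measurable_subtype_coe hB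
    rw [lintegral_const_mul _ (by fun_prop (disch := exact hBs)), lintegral_indicator_const hBs,
      one_mul]
  have e1 := hsplit hh hA hcon
  have e2 := hsplit hh MeasurableSet.univ (by simp)
  have e3 := hsplit (g := fun _ => 1) (by fun_prop) hA hcon
  have e4 := hsplit (g := fun _ => 1) (by fun_prop) (B := univ) MeasurableSet.univ (by simp)
  simp only [one_mul, indicator_univ, mul_one, preimage_univ, lintegral_one, measure_univ,
    lintegral_indicator_const hA] at e1 e2 e3 e4
  rw [e1, e2, e3]
  -- The 1 is the total mass, itself such a product; inserting it avoids division in [0, ∞].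
  conv_lhs => rw [← mul_one (lintegral _ _ * _), e4]
  ring

/-- The sphere has n times the volume of the unit ball, and Γ(n/2 + 1) = (n/2) Γ(n/2). -/
theorem toSphere_univ_eq_omega [Nontrivial V] :
    (volume : Measure V).toSphere univ = ENNReal.ofReal (omega (Module.finrank ℝ V)) := by
  rw [Measure.toSphere_apply_univ, InnerProductSpace.volume_ball]
  set n := Module.finrank ℝ V with hn
  have hn0 : (0 : ℝ) < n := by exact_mod_cast Module.finrank_pos
  rw [ENNReal.ofReal_one, one_pow, one_mul, ← ENNReal.ofReal_natCast,
    ← ENNReal.ofReal_mul (by positivity), omega, Real.Gamma_add_one (by positivity),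
    Real.sqrt_eq_rpow, ← Real.rpow_natCast, ← Real.rpow_mul (by positivity)]
  congr 1
  rw [one_div_mul_eq_div]
  have := (Real.Gamma_pos_of_pos (half_pos hn0)).ne'
  field_simp

theorem lintegral_norm_stdGaussian [Nontrivial V] {h : ℝ → ℝ≥0∞} (hh : Measurable h) :
    ∫⁻ x, h ‖x‖ ∂stdGaussian V =
      ENNReal.ofReal (omega (Module.finrank ℝ V) / √(2 * Real.pi) ^ Module.finrank ℝ V) *
        ∫⁻ r in Ioi (0 : ℝ), h r *
          ENNReal.ofReal (Real.exp (-(1 / 2) * r ^ 2) * r ^ (Module.finrank ℝ V - 1)) := by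
  rw [lintegral_stdGaussian_polar (by fun_prop)]
  have hin : ∀ u : Metric.sphere (0 : V) 1,
      ∫⁻ r in Ioi (0 : ℝ), h ‖r • (u : V)‖ *
        ENNReal.ofReal ((√(2 * Real.pi) ^ Module.finrank ℝ V)⁻¹ *
          (Real.exp (-(1 / 2) * r ^ 2) * r ^ (Module.finrank ℝ V - 1))) =
      ENNReal.ofReal (√(2 * Real.pi) ^ Module.finrank ℝ V)⁻¹ * ∫⁻ r in Ioi (0 : ℝ), h r *
        ENNReal.ofReal (Real.exp (-(1 / 2) * r ^ 2) * r ^ (Module.finrank ℝ V - 1)) := by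
    intro u
    rw [← lintegral_const_mul _ (by fun_prop)]
    refine setLIntegral_congr_fun measurableSet_Ioi fun r hr => ?_
    have hr : 0 < r := hr
    have hnorm : ‖r • (u : V)‖ = r := by simp [norm_smul, abs_of_pos hr]
    simp only [hnorm]
    rw [ENNReal.ofReal_mul (by positivity), mul_left_comm]
  refine (lintegral_congr hin).trans ?_
  rw [lintegral_const, toSphere_univ_eq_omega, div_eq_inv_mul (omega _),
    ENNReal.ofReal_mul (by positivity)]
  ring

end Gaussian

/-! ### Moreau decomposition of a point along a cone and its polar. -/

section Moreau

variable {d : ℕ} (C : ProperCone ℝ (E d))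

theorem smul_mem_cone {C : ProperCone ℝ (E d)} {t : ℝ} {y : E d} (hy : y ∈ C) (ht : 0 ≤ t) :
    t • y ∈ C := C.smul_mem hy ht

theorem add_mem_cone {C : ProperCone ℝ (E d)} {x y : E d} (hx : x ∈ C) (hy : y ∈ C) :
    x + y ∈ C := C.toPointedCone.add_mem hx hy

/-- First-order optimality of the nearest point along admissible directions. -/
theorem inner_sub_proj_nonpos_of_forall_mem (x v : E d)
    (hv : ∀ t : ℝ, 0 < t → t < 1 → proj C x + t • v ∈ C) :
    inner ℝ (x - proj C x) v ≤ 0 := by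
  by_contra! hpos
  set p := proj C x
  set c := inner ℝ (x - p) v
  have key : ∀ t : ℝ, 0 < t → t < 1 → 2 * c ≤ t * ‖v‖ ^ 2 := by
    intro t ht ht1
    have h := norm_sub_proj_le C x _ (hv t ht ht1)
    have h2 : ‖x - p‖ ^ 2 ≤ ‖x - p - t • v‖ ^ 2 := by
      rw [sub_sub]; gcongr
    rw [norm_sub_sq_real (x - p), inner_smul_right, norm_smul, mul_pow, Real.norm_eq_abs,
      sq_abs] at h2
    have : t * (2 * c) ≤ t * (t * ‖v‖ ^ 2) := by linarith
    exact le_of_mul_le_mul_left this ht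
  have hd : 0 < c + ‖v‖ ^ 2 := by positivity
  -- This t lies below 1, and t‖v‖² ≤ c < 2c contradicts `key`.
  have h := key (c / (c + ‖v‖ ^ 2) / 2) (by positivity) (by
    have : c / (c + ‖v‖ ^ 2) ≤ 1 := (div_le_one hd).2 (by nlinarith [sq_nonneg ‖v‖])
    linarith)
  have h' : c / (c + ‖v‖ ^ 2) / 2 * ‖v‖ ^ 2 ≤ c := by
    rw [div_div, div_mul_eq_mul_div, div_le_iff₀ (by positivity)]
    nlinarith [sq_nonneg ‖v‖, mul_nonneg hpos.le (sq_nonneg ‖v‖)]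
  linarith

theorem sub_proj_mem_polar (x : E d) : x - proj C x ∈ polar C := by
  rw [mem_polar]
  intro y hy
  exact inner_sub_proj_nonpos_of_forall_mem C x y fun t ht _ =>
    add_mem_cone (proj_mem C x) (smul_mem_cone hy ht.le)

theorem inner_sub_proj_self (x : E d) : inner ℝ (x - proj C x) (proj C x) = 0 := by
  refine le_antisymm ((mem_polar C _).1 (sub_proj_mem_polar C x) _ (proj_mem C x)) ?_
  have h := inner_sub_proj_nonpos_of_forall_mem C x (-proj C x) fun t ht ht1 => by
    have : proj C x + t • -proj C x = (1 - t) • proj C x := by module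
    rw [this]
    exact smul_mem_cone (proj_mem C x) (by linarith)
  rw [inner_neg_right] at h
  linarith

variable {C}

/-- Expanding, ‖(p - y) + q‖² = ‖p - y‖² + ‖q‖² - 2⟪y, q⟫ ≥ ‖q‖², because ⟪y, q⟫ ≤ 0. -/
theorem proj_add_eq_left {p q : E d} (hp : p ∈ C) (hq : q ∈ polar C) (hpq : inner ℝ p q = 0) :
    proj C (p + q) = p := by
  refine (eq_proj_of_nearest C _ p hp fun y hy => ?_).symm
  have h1 := (mem_polar C q).1 hq y hy
  rw [show p + q - y = (p - y) + q by abel, add_sub_cancel_left]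
  refine le_of_sq_le_sq ?_ (norm_nonneg _)
  rw [norm_add_sq_real, inner_sub_left, hpq, real_inner_comm]
  nlinarith [sq_nonneg ‖p - y‖]

theorem proj_polar_add_eq_right {p q : E d} (hp : p ∈ C) (hq : q ∈ polar C)
    (hpq : inner ℝ p q = 0) : proj (polar C) (p + q) = q := by
  refine (eq_proj_of_nearest (polar C) _ q hq fun y hy => ?_).symm
  have h1 := (mem_polar C y).1 hy p hp
  rw [show p + q - y = (q - y) + p by abel, add_sub_cancel_right]
  refine le_of_sq_le_sq ?_ (norm_nonneg _)
  rw [norm_add_sq_real, inner_sub_left, real_inner_comm, hpq]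
  nlinarith [sq_nonneg ‖q - y‖]

theorem proj_polar_eq_sub (C : ProperCone ℝ (E d)) (x : E d) :
    proj (polar C) x = x - proj C x := by
  have h := proj_polar_add_eq_right (proj_mem C x) (sub_proj_mem_polar C x)
    (by rw [real_inner_comm]; exact inner_sub_proj_self C x)
  rwa [add_sub_cancel] at h

end Moreau

/-! ### Strata by active constraints, their faces, and projections onto them. -/

section Strata

variable {d : ℕ}

/-- From a relative interior point the segment coming from z can be prolonged slightly within the
affine hull without leaving S. -/
theorem exists_lineMap_neg_mem_of_mem_intrinsicInterior {S : Set (E d)} {x z : E d}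
    (hx : x ∈ intrinsicInterior ℝ S) (hz : z ∈ S) :
    ∃ ε : ℝ, 0 < ε ∧ AffineMap.lineMap x z (-ε) ∈ S := by
  obtain ⟨y, hy, rfl⟩ := mem_intrinsicInterior.1 hx
  let φ : ℝ → affineSpan ℝ S := fun t =>
    ⟨AffineMap.lineMap (y : E d) z (-t),
      AffineMap.lineMap_mem _ y.2 (subset_affineSpan ℝ S hz)⟩
  have hφ : Continuous φ := by
    refine Continuous.subtype_mk ?_ _
    simp only [AffineMap.lineMap_apply]
    fun_prop
  have h0 : φ 0 = y := Subtype.ext (by simp [φ])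
  have hev : ∀ᶠ t in nhds (0 : ℝ), φ t ∈ ((↑) ⁻¹' S : Set (affineSpan ℝ S)) :=
    hφ.continuousAt.eventually (h0 ▸ mem_interior_iff_mem_nhds.1 hy)
  obtain ⟨ε, hε, h⟩ := ((hev.filter_mono nhdsWithin_le_nhds).and
    (self_mem_nhdsWithin (s := Ioi (0 : ℝ)))).exists
  exact ⟨ε, h, hε⟩

/-- The common kernel of a finite family of linear functionals. -/
def activeSpace (I : Finset (E d)) : Submodule ℝ (E d) :=
  (Submodule.span ℝ (I : Set (E d)))ᗮ

theorem mem_activeSpace {I : Finset (E d)} {x : E d} :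
    x ∈ activeSpace I ↔ ∀ a ∈ I, inner ℝ a x = 0 := by
  rw [activeSpace, Submodule.mem_orthogonal]
  refine ⟨fun h a ha => h a (Submodule.subset_span ha), fun h u hu => ?_⟩
  induction hu using Submodule.span_induction with
  | mem a ha => exact h a ha
  | zero => exact inner_zero_left _
  | add a b _ _ ha hb => rw [inner_add_left, ha, hb, add_zero]
  | smul c a _ ha => rw [inner_smul_left, ha, mul_zero]

/-- The face of `C` on which the constraints in `I` are active. -/
def activeFace (C : ProperCone ℝ (E d)) (I : Finset (E d)) : PointedCone ℝ (E d) :=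
  C.toPointedCone ⊓ PointedCone.ofSubmodule (activeSpace I)

theorem mem_activeFace {C : ProperCone ℝ (E d)} {I : Finset (E d)} {x : E d} :
    x ∈ activeFace C I ↔ x ∈ C ∧ x ∈ activeSpace I := Iff.rfl

/-- The points of `C` at which, among the constraints in `s`, exactly those in `I` are active. -/
def stratum (C : ProperCone ℝ (E d)) (s I : Finset (E d)) : Set (E d) :=
  {x | x ∈ C ∧ ∀ a ∈ s, inner ℝ a x = 0 ↔ a ∈ I}

theorem measurableSet_stratum (C : ProperCone ℝ (E d)) (s I : Finset (E d)) :
    MeasurableSet (stratum C s I) := by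
  have h : stratum C s I = (C : Set (E d)) ∩ ⋂ a ∈ s, {x | inner ℝ a x = 0 ↔ a ∈ I} := by
    ext x; simp [stratum]
  rw [h]
  refine C.isClosed.measurableSet.inter (Finset.measurableSet_biInter _ fun a _ => ?_)
  by_cases ha : a ∈ I
  · simpa only [ha, iff_true] using measurableSet_eq_fun (by fun_prop) measurable_const
  · simp only [ha, iff_false]
    exact (measurableSet_eq_fun (by fun_prop) measurable_const).compl

theorem smul_mem_stratum {C : ProperCone ℝ (E d)} {s I : Finset (E d)} {x : E d}
    (hx : x ∈ stratum C s I) {t : ℝ} (ht : 0 < t) : t • x ∈ stratum C s I := by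
  refine ⟨smul_mem_cone hx.1 ht.le, fun a ha => ?_⟩
  rw [inner_smul_right, mul_eq_zero, or_iff_right ht.ne']
  exact hx.2 a ha

open scoped Classical in
/-- The constraints in `s` which are active at `x`. -/
def activeSet (s : Finset (E d)) (x : E d) : Finset (E d) :=
  s.filter fun a => inner ℝ a x = 0

theorem mem_stratum_iff {C : ProperCone ℝ (E d)} {s I : Finset (E d)} (hI : I ⊆ s) {x : E d} :
    x ∈ stratum C s I ↔ x ∈ C ∧ activeSet s x = I := by
  refine and_congr_right fun _ => ?_
  rw [Finset.ext_iff]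
  refine forall_congr' fun a => ?_
  simp only [activeSet, Finset.mem_filter]
  have := @hI a
  tauto

variable {C : ProperCone ℝ (E d)} {s I : Finset (E d)}
  (hs : ∀ x : E d, x ∈ C ↔ ∀ a ∈ s, inner ℝ a x ≤ 0) (hI : I ⊆ s)

include hI in
theorem stratum_subset_activeSpace {x : E d} (hx : x ∈ stratum C s I) : x ∈ activeSpace I :=
  mem_activeSpace.2 fun a ha => (hx.2 a (hI ha)).2 ha

include hI in
theorem stratum_subset_activeFace {x : E d} (hx : x ∈ stratum C s I) : x ∈ activeFace C I :=
  mem_activeFace.2 ⟨hx.1, stratum_subset_activeSpace hI hx⟩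

include hs in
-- Inactive constraints are strict at x and stay so nearby; the active ones vanish on `activeSpace
-- I`.
theorem eventually_mem_of_mem_stratum {x : E d} (hx : x ∈ stratum C s I) :
    ∀ᶠ y in nhds x, y ∈ activeSpace I → y ∈ C := by
  have h : ∀ a ∈ s, ∀ᶠ y in nhds x, y ∈ activeSpace I → inner ℝ a y ≤ 0 := by
    intro a ha
    by_cases haI : a ∈ I
    · exact .of_forall fun y hy => (mem_activeSpace.1 hy a haI).le
    · have hlt : inner ℝ a x < 0 :=
        lt_of_le_of_ne ((hs x).1 hx.1 a ha) fun h0 => haI ((hx.2 a ha).1 h0)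
      have hc : Continuous fun y : E d => inner ℝ a y := by fun_prop
      filter_upwards [hc.continuousAt.eventually_lt continuousAt_const hlt] with y hy _
      exact hy.le
  filter_upwards [(Filter.eventually_all_finset s).2 h] with y hy hyI
  exact (hs y).2 fun a ha => hy a ha hyI

include hs in
theorem exists_add_smul_mem_of_mem_stratum {x v : E d} (hx : x ∈ stratum C s I)
    (hxI : x ∈ activeSpace I) (hv : v ∈ activeSpace I) : ∃ ε : ℝ, 0 < ε ∧ x + ε • v ∈ C := by
  have hc : Filter.Tendsto (fun t : ℝ => x + t • v) (nhds 0) (nhds x) := by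
    have : Continuous fun t : ℝ => x + t • v := by fun_prop
    simpa using this.tendsto 0
  obtain ⟨ε, h, hε⟩ := (((hc.eventually (eventually_mem_of_mem_stratum hs hx)).filter_mono
    nhdsWithin_le_nhds).and (self_mem_nhdsWithin (s := Ioi (0 : ℝ)))).exists
  exact ⟨ε, hε, h ((activeSpace I).add_mem hxI ((activeSpace I).smul_mem _ hv))⟩

include hs hI in
theorem isFaceOf_activeFace : (activeFace C I).IsFaceOf C.toPointedCone := by
  refine ⟨fun x hx => (mem_activeFace.1 hx).1, fun {x y a} hx hy ha h => ?_⟩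
  refine mem_activeFace.2 ⟨hx, mem_activeSpace.2 fun b hb => ?_⟩
  have h0 := mem_activeSpace.1 (mem_activeFace.1 h).2 b hb
  rw [inner_add_right, inner_smul_right] at h0
  have h1 := (hs x).1 hx b (hI hb)
  have h2 := (hs y).1 hy b (hI hb)
  -- Two nonpositive terms, one with weight `a` > 0, sum to zero, so both vanish.
  nlinarith

include hs hI in
theorem span_activeFace {x : E d} (hx : x ∈ stratum C s I) :
    Submodule.span ℝ (activeFace C I : Set (E d)) = activeSpace I := by
  have hxI := stratum_subset_activeSpace hI hx
  refine le_antisymm (Submodule.span_le.2 fun y hy => (mem_activeFace.1 hy).2) fun v hv => ?_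
  obtain ⟨ε, hε, h⟩ := exists_add_smul_mem_of_mem_stratum hs hx hxI hv
  have hmem : x + ε • v ∈ activeFace C I := mem_activeFace.2
    ⟨h, (activeSpace I).add_mem hxI ((activeSpace I).smul_mem _ hv)⟩
  have hv' : v = ε⁻¹ • ((x + ε • v) - x) := by
    rw [add_sub_cancel_left, smul_smul, inv_mul_cancel₀ hε.ne', one_smul]
  rw [hv']
  exact Submodule.smul_mem _ _ (Submodule.sub_mem _ (Submodule.subset_span hmem)
    (Submodule.subset_span (stratum_subset_activeFace hI hx)))

include hs hI in
theorem mem_intrinsicInterior_activeFace {x : E d} (hx : x ∈ stratum C s I) :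
    x ∈ intrinsicInterior ℝ (activeFace C I : Set (E d)) := by
  have hxF := stratum_subset_activeFace hI hx
  refine mem_intrinsicInterior.2 ⟨⟨x, subset_affineSpan ℝ _ hxF⟩, ?_, rfl⟩
  rw [mem_interior_iff_mem_nhds]
  have hle : affineSpan ℝ (activeFace C I : Set (E d)) ≤ (activeSpace I).toAffineSubspace :=
    affineSpan_le.2 fun y hy => (mem_activeFace.1 hy).2
  have hev := (continuous_subtype_val (p := fun y =>
    y ∈ affineSpan ℝ (activeFace C I : Set (E d)))).tendsto ⟨x, subset_affineSpan ℝ _ hxF⟩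
    |>.eventually (eventually_mem_of_mem_stratum hs hx)
  filter_upwards [hev] with y hy
  exact mem_activeFace.2 ⟨hy (hle y.2), hle y.2⟩

include hs hI in
/-- A point of a stratum lies in the relative interior of only one face. -/
theorem eq_activeFace_of_mem_intrinsicInterior {x : E d} (hx : x ∈ stratum C s I)
    {F : PointedCone ℝ (E d)} (hF : F.IsFaceOf C.toPointedCone)
    (hxF : x ∈ intrinsicInterior ℝ (F : Set (E d))) : F = activeFace C I := by
  have hxI := stratum_subset_activeSpace hI hx
  have hxmem : x ∈ F := intrinsicInterior_subset hxF
  ext y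
  constructor
  · intro hy
    refine mem_activeFace.2 ⟨hF.le hy, mem_activeSpace.2 fun a ha => ?_⟩
    -- The point (1 + ε)x - εy is in C and ⟪a, x⟫ = 0, so ⟪a, y⟫ ≥ 0 as well as ≤ 0.
    obtain ⟨ε, hε, h⟩ := exists_lineMap_neg_mem_of_mem_intrinsicInterior hxF hy
    have h1 := (hs _).1 (hF.le h) a (hI ha)
    have h2 := (hs _).1 (hF.le hy) a (hI ha)
    rw [AffineMap.lineMap_apply_module, inner_add_right, inner_smul_right, inner_smul_right,
      mem_activeSpace.1 hxI a ha] at h1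
    nlinarith
  · intro hy
    obtain ⟨hyC, hyI⟩ := mem_activeFace.1 hy
    -- Then x = εy + (x - εy) splits a point of F inside C, and the face property puts y in F.
    obtain ⟨ε, hε, h⟩ := exists_add_smul_mem_of_mem_stratum hs hx hxI
      ((activeSpace I).neg_mem hyI)
    refine hF.mem_of_smul_add_mem (a := ε) hyC h hε ?_
    have : ε • y + (x + ε • -y) = x := by module
    rwa [this]

include hs hI in
theorem mem_skel_iff_of_mem_stratum {x : E d} (hx : x ∈ stratum C s I) (k : ℕ) :
    x ∈ skel k C ↔ Module.finrank ℝ (activeSpace I) = k := by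
  constructor
  · rintro ⟨F, hF, hk, hxF⟩
    rw [eq_activeFace_of_mem_intrinsicInterior hs hI hx hF hxF, span_activeFace hs hI hx] at hk
    exact hk
  · intro hk
    exact ⟨activeFace C I, isFaceOf_activeFace hs hI, by rw [span_activeFace hs hI hx, hk],
      mem_intrinsicInterior_activeFace hs hI hx⟩

include hs hI in
theorem proj_eq_of_proj_mem_stratum {g : E d} (hg : proj C g ∈ stratum C s I) :
    proj C g = (activeSpace I).starProjection g ∧
      proj (polar C) g = (activeSpace I)ᗮ.starProjection g := by
  have hpI := stratum_subset_activeSpace hI hg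
  -- The residual is polar to C and orthogonal to Π_C(g), and x + εv stays in C; applying this to v
  -- and -v gives orthogonality.
  have hle : ∀ v ∈ activeSpace I, inner ℝ (g - proj C g) v ≤ 0 := by
    intro v hv
    obtain ⟨ε, hε, h⟩ := exists_add_smul_mem_of_mem_stratum hs hg hpI hv
    have h1 := (mem_polar C _).1 (sub_proj_mem_polar C g) _ h
    rw [inner_add_right, inner_sub_proj_self, inner_smul_right, zero_add] at h1
    exact nonpos_of_mul_nonpos_right h1 hε
  have horth : g - proj C g ∈ (activeSpace I)ᗮ := by
    rw [Submodule.mem_orthogonal']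
    intro v hv
    refine le_antisymm (hle v hv) ?_
    have := hle (-v) ((activeSpace I).neg_mem hv)
    rw [inner_neg_right] at this
    linarith
  have h1 : proj C g = (activeSpace I).starProjection g :=
    (Submodule.eq_starProjection_of_mem_orthogonal hpI horth).symm
  refine ⟨h1, ?_⟩
  rw [proj_polar_eq_sub, h1, Submodule.starProjection_orthogonal_val]

theorem proj_eq_of_starProjection_mem {C : ProperCone ℝ (E d)} {L : Submodule ℝ (E d)} {g : E d}
    (h1 : L.starProjection g ∈ C) (h2 : Lᗮ.starProjection g ∈ polar C) :
    proj C g = L.starProjection g ∧ proj (polar C) g = Lᗮ.starProjection g := by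
  have h0 : inner ℝ (L.starProjection g) (Lᗮ.starProjection g) = 0 :=
    Submodule.inner_right_of_mem_orthogonal (Submodule.starProjection_apply_mem _ _)
      (Submodule.starProjection_apply_mem _ _)
  have hg := Submodule.starProjection_add_starProjection_orthogonal (K := L) g
  have e1 := proj_add_eq_left h1 h2 h0
  have e2 := proj_polar_add_eq_right h1 h2 h0
  rw [hg] at e1 e2
  exact ⟨e1, e2⟩

include hs hI in
-- This decouples the event into one condition on each of the two independent components of g.
theorem proj_mem_stratum_iff {g : E d} :
    proj C g ∈ stratum C s I ↔
      (activeSpace I).starProjection g ∈ stratum C s I ∧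
        (activeSpace I)ᗮ.starProjection g ∈ polar C := by
  constructor
  · intro h
    obtain ⟨h1, h2⟩ := proj_eq_of_proj_mem_stratum hs hI h
    rw [← h1, ← h2]
    exact ⟨h, proj_mem _ _⟩
  · rintro ⟨h1, h2⟩
    rw [(proj_eq_of_starProjection_mem h1.1 h2).1]
    exact h1

end Strata

/-! ### Independence of norms and biconic events. -/

section Factorization

variable {V : Type*} [NormedAddCommGroup V] [InnerProductSpace ℝ V] [FiniteDimensional ℝ V]
  [MeasurableSpace V] [BorelSpace V]

/-- The norms of the two orthogonal components of a standard Gaussian vector are independent of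
their directions. -/
theorem lintegral_norms_mul_indicator_biconic (L : Submodule ℝ V) {H : ℝ × ℝ → ℝ≥0∞}
    (hH : Measurable H) {A : Set (V × V)} (hA : MeasurableSet A)
    (hcon : ∀ p ∈ A, ∀ a b : ℝ, 0 < a → 0 < b → (a • p.1, b • p.2) ∈ A) :
    ∫⁻ x, H (‖L.starProjection x‖, ‖Lᗮ.starProjection x‖) *
        A.indicator (fun _ => 1) (L.starProjection x, Lᗮ.starProjection x) ∂stdGaussian V =
      (∫⁻ x, H (‖L.starProjection x‖, ‖Lᗮ.starProjection x‖) ∂stdGaussian V) *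
        stdGaussian V {x | (L.starProjection x, Lᗮ.starProjection x) ∈ A} := by
  have hind : Measurable (A.indicator (fun _ => (1 : ℝ≥0∞))) := measurable_const.indicator hA
  have hright : ∀ a : L, MeasurableSet {b : Lᗮ | ((a : V), (b : V)) ∈ A} := fun a =>
    (show Measurable fun b : Lᗮ => ((a : V), (b : V)) by fun_prop) hA
  have hleft : ∀ b : Lᗮ, MeasurableSet {a : L | ((a : V), (b : V)) ∈ A} := fun b =>
    (show Measurable fun a : L => ((a : V), (b : V)) by fun_prop) hA
  have hpre : MeasurableSet {x : V | (L.starProjection x, Lᗮ.starProjection x) ∈ A} :=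
    (show Measurable fun x : V => (L.starProjection x, Lᗮ.starProjection x) by fun_prop) hA
  set G : ℝ → ℝ≥0∞ := fun r => ∫⁻ b, H (r, ‖b‖) ∂stdGaussian Lᗮ with hG
  have hGm : Measurable G :=
    Measurable.lintegral_prod_right' (f := fun p : ℝ × Lᗮ => H (p.1, ‖p.2‖)) (by fun_prop)
  have hmeas : stdGaussian V {x | (L.starProjection x, Lᗮ.starProjection x) ∈ A} =
      ∫⁻ b, stdGaussian L {a : L | ((a : V), (b : V)) ∈ A} ∂stdGaussian Lᗮ := by
    have h1 := lintegral_stdGaussian_starProjection L hind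
    have h2 : ∫⁻ x, A.indicator (fun _ => (1 : ℝ≥0∞)) (L.starProjection x, Lᗮ.starProjection x)
        ∂stdGaussian V = stdGaussian V {x | (L.starProjection x, Lᗮ.starProjection x) ∈ A} :=
      lintegral_indicator_one hpre
    rw [← h2, h1, lintegral_lintegral_swap (by fun_prop)]
    exact lintegral_congr fun b => lintegral_indicator_one (hleft b)
  rw [lintegral_stdGaussian_starProjection L (g := fun p => H (‖p.1‖, ‖p.2‖) *
      A.indicator (fun _ => 1) p) (by fun_prop),
    lintegral_stdGaussian_starProjection L (g := fun p => H (‖p.1‖, ‖p.2‖)) (by fun_prop), hmeas]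
  -- Slices of a biconic set are conic. For fixed a this averages out ‖b‖, leaving `G`; after
  -- exchanging the integrals the same argument averages out ‖a‖.
  calc ∫⁻ a, ∫⁻ b, H (‖(a : V)‖, ‖(b : V)‖) * A.indicator (fun _ => 1) ((a : V), (b : V))
        ∂stdGaussian Lᗮ ∂stdGaussian L
      = ∫⁻ a, ∫⁻ b, G ‖a‖ * A.indicator (fun _ => 1) ((a : V), (b : V))
        ∂stdGaussian Lᗮ ∂stdGaussian L := by
        refine lintegral_congr fun a => ?_
        rw [lintegral_const_mul _ (by fun_prop)]
        have h := lintegral_norm_mul_indicator_conic (V := Lᗮ) (h := fun t => H (‖a‖, t))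
          (by fun_prop) (hright a) (fun b hb t ht => by
            have := hcon _ hb 1 t one_pos ht
            rw [one_smul] at this
            exact this)
        rw [← lintegral_indicator_one (hright a)] at h
        exact h
    _ = ∫⁻ b, ∫⁻ a, G ‖a‖ * A.indicator (fun _ => 1) ((a : V), (b : V))
        ∂stdGaussian L ∂stdGaussian Lᗮ := lintegral_lintegral_swap (by fun_prop)
    _ = ∫⁻ b, (∫⁻ a, G ‖a‖ ∂stdGaussian L) * stdGaussian L {a : L | ((a : V), (b : V)) ∈ A}
        ∂stdGaussian Lᗮ := by
        refine lintegral_congr fun b => ?_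
        exact lintegral_norm_mul_indicator_conic (V := L) hGm (hleft b) (fun a ha t ht => by
            have := hcon _ ha t 1 ht one_pos
            rw [one_smul] at this
            exact this)
    _ = _ := by
        rw [lintegral_const_mul]
        · rfl
        · simp only [← lintegral_indicator_one (hleft _)]
          exact Measurable.lintegral_prod_left'
            (f := fun p : L × Lᗮ => A.indicator (fun _ => (1 : ℝ≥0∞)) ((p.1 : V), (p.2 : V)))
            (by fun_prop)

end Factorization

/-! ### The coefficients as Gaussian means over a subspace and its complement. -/

section Coefficients

variable {d : ℕ}

/-- The mean of `f (‖x‖², ‖y‖²)` over the orthogonal components `x`, `y` of a standard Gaussian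
vector along `L` and its orthogonal complement. -/
def subspaceMean (f : ℝ≥0 × ℝ≥0 → ℝ≥0) (L : Submodule ℝ (E d)) : ℝ≥0∞ :=
  ∫⁻ g, (f (‖L.starProjection g‖₊ ^ 2, ‖Lᗮ.starProjection g‖₊ ^ 2) : ℝ≥0∞) ∂stdGaussian (E d)

theorem nnnorm_sq_eq_toNNReal {V : Type*} [NormedAddCommGroup V] (x : V) :
    ‖x‖₊ ^ 2 = Real.toNNReal (‖x‖ ^ 2) := by
  rw [Real.toNNReal_pow (norm_nonneg x), norm_toNNReal]

theorem phi_subspaceCone (f : ℝ≥0 × ℝ≥0 → ℝ≥0) (L : Submodule ℝ (E d)) :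
    phi f (subspaceCone L) univ = subspaceMean f L := by
  refine lintegral_congr fun g => ?_
  have hpol : Lᗮ.starProjection g ∈ polar (subspaceCone L) := by
    rw [mem_polar]
    intro y hy
    exact (Submodule.inner_left_of_mem_orthogonal ((mem_subspaceCone L y).1 hy)
      (Submodule.starProjection_apply_mem _ _)).le
  obtain ⟨h1, h2⟩ := proj_eq_of_starProjection_mem
    ((mem_subspaceCone L _).2 (Submodule.starProjection_apply_mem L g)) hpol
  rw [h1, h2, indicator_univ, mul_one]

theorem subspaceMean_eq_coeffI (hd : 2 ≤ d) {f : ℝ≥0 × ℝ≥0 → ℝ≥0} (hf : Measurable f)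
    (L : Submodule ℝ (E d)) : subspaceMean f L = coeffI d f (Module.finrank ℝ L) := by
  set F : ℝ × ℝ → ℝ≥0∞ := fun p => (f (Real.toNNReal (p.1 ^ 2), Real.toNNReal (p.2 ^ 2)) : ℝ≥0∞)
    with hF
  have hFm : Measurable F := by fun_prop
  have hsum : Module.finrank ℝ L + Module.finrank ℝ Lᗮ = d := by
    rw [Submodule.finrank_add_finrank_orthogonal, finrank_euclideanSpace_fin]
  have hJ : subspaceMean f L = ∫⁻ a : L, ∫⁻ b : Lᗮ, F (‖a‖, ‖b‖)
      ∂stdGaussian Lᗮ ∂stdGaussian L := by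
    rw [subspaceMean]
    simp only [nnnorm_sq_eq_toNNReal]
    exact lintegral_stdGaussian_starProjection L (g := fun p => F (‖p.1‖, ‖p.2‖)) (by fun_prop)
  have hzero : ∀ (K : Submodule ℝ (E d)), Module.finrank ℝ K = 0 → ∀ x : K, ‖x‖ = 0 := by
    intro K hK x
    have := Module.finrank_zero_iff.1 hK
    rw [Subsingleton.elim x 0, norm_zero]
  rw [hJ, coeffI]
  split_ifs with h0 hk
  -- In dimension 0 the component along L vanishes and only the integral over Lᗮ remains; dimension
  -- d is symmetric.
  · have hM : Module.finrank ℝ Lᗮ = d := by omega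
    have : Nontrivial Lᗮ := Module.nontrivial_of_finrank_pos (R := ℝ) (by omega)
    simp only [hzero L h0, lintegral_const, measure_univ, mul_one]
    rw [lintegral_norm_stdGaussian (V := Lᗮ) (h := fun t => F (0, t)) (by fun_prop), hM]
    simp [hF]
  · have hM : Module.finrank ℝ Lᗮ = 0 := by omega
    have : Nontrivial L := Module.nontrivial_of_finrank_pos (R := ℝ) (by omega)
    simp only [hzero Lᗮ hM, lintegral_const, measure_univ, mul_one]
    rw [lintegral_norm_stdGaussian (V := L) (h := fun t => F (t, 0)) (by fun_prop), hk]
    simp [hF]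
  · have : Nontrivial L := Module.nontrivial_of_finrank_pos (R := ℝ) (by omega)
    have : Nontrivial Lᗮ := Module.nontrivial_of_finrank_pos (R := ℝ) (by omega)
    set k := Module.finrank ℝ L with hkdef
    have hM : Module.finrank ℝ Lᗮ = d - k := by omega
    have hmI : Measurable fun r => ∫⁻ s in Ioi (0 : ℝ), F (r, s) *
        ENNReal.ofReal (Real.exp (-(1 / 2) * s ^ 2) * s ^ (d - k - 1)) :=
      Measurable.lintegral_prod_right' (f := fun p : ℝ × ℝ => F (p.1, p.2) *
        ENNReal.ofReal (Real.exp (-(1 / 2) * p.2 ^ 2) * p.2 ^ (d - k - 1))) (by fun_prop)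
    have hin : ∀ a : L, ∫⁻ b : Lᗮ, F (‖a‖, ‖b‖) ∂stdGaussian Lᗮ =
        ENNReal.ofReal (omega (d - k) / √(2 * Real.pi) ^ (d - k)) *
          ∫⁻ s in Ioi (0 : ℝ), F (‖a‖, s) *
            ENNReal.ofReal (Real.exp (-(1 / 2) * s ^ 2) * s ^ (d - k - 1)) := by
      intro a
      rw [lintegral_norm_stdGaussian (V := Lᗮ) (h := fun t => F (‖a‖, t)) (by fun_prop), hM]
    have hout := lintegral_norm_stdGaussian (V := L) (hmI.const_mul
      (ENNReal.ofReal (omega (d - k) / √(2 * Real.pi) ^ (d - k))))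
    rw [lintegral_congr hin, hout, ← hkdef]
    have homega : ∀ n : ℕ, 0 ≤ omega n := fun n => by
      have := Real.Gamma_nonneg_of_nonneg (s := (n : ℝ) / 2) (by positivity)
      unfold omega
      positivity
    have hc : omega k * omega (d - k) / √(2 * Real.pi) ^ d =
        (omega k / √(2 * Real.pi) ^ k) * (omega (d - k) / √(2 * Real.pi) ^ (d - k)) := by
      rw [div_mul_div_comm, ← pow_add, Nat.add_sub_cancel' (by omega)]
    have hck : 0 ≤ omega k / √(2 * Real.pi) ^ k := div_nonneg (homega k) (by positivity)
    rw [hc, ENNReal.ofReal_mul hck, mul_assoc]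
    congr 1
    rw [← lintegral_const_mul _ (by fun_prop)]
    refine setLIntegral_congr_fun measurableSet_Ioi fun r hr => ?_
    have hr : 0 < r := hr
    rw [mul_assoc]
    congr 1
    rw [← lintegral_mul_const _ (by fun_prop)]
    refine setLIntegral_congr_fun measurableSet_Ioi fun s hs => ?_
    have hs : 0 < s := hs
    rw [mul_assoc, ← ENNReal.ofReal_mul (by positivity), mul_add, Real.exp_add]
    congr 2
    ring

end Coefficients

/-! ### Summing over the strata. -/

section Decomposition

variable {d : ℕ} {C : ProperCone ℝ (E d)} {s : Finset (E d)}
  (hs : ∀ x : E d, x ∈ C ↔ ∀ a ∈ s, inner ℝ a x ≤ 0) {η : Set (E d × E d)}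

/-- The part of `η` lying over a stratum. -/
def stratumPart (C : ProperCone ℝ (E d)) (s I : Finset (E d)) (η : Set (E d × E d)) :
    Set (E d × E d) :=
  (stratum C s I ×ˢ (polar C : Set (E d))) ∩ η

theorem isBiconic_stratumPart (I : Finset (E d)) (hη : IsBiconic η) :
    IsBiconic (stratumPart C s I η) := by
  refine ⟨((measurableSet_stratum C s I).prod (polar C).isClosed.measurableSet).inter hη.1, ?_⟩
  rintro p ⟨⟨h1, h2⟩, h3⟩ a b ha hb
  exact ⟨⟨smul_mem_stratum h1 ha, smul_mem_cone h2 hb.le⟩, hη.2 p h3 a b ha hb⟩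

/-- The event that the projection to `C` lies in the given stratum and that the pair of projections
lies in `η`. -/
def stratumEvent (C : ProperCone ℝ (E d)) (s I : Finset (E d)) (η : Set (E d × E d)) :
    Set (E d) :=
  {g | proj C g ∈ stratum C s I ∧ (proj C g, proj (polar C) g) ∈ η}

include hs in
theorem mem_stratumEvent_iff {I : Finset (E d)} (hI : I ⊆ s) {g : E d} :
    g ∈ stratumEvent C s I η ↔ ((activeSpace I).starProjection g,
      (activeSpace I)ᗮ.starProjection g) ∈ stratumPart C s I η := by
  have h := proj_mem_stratum_iff hs hI (g := g)
  constructor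
  · rintro ⟨h1, h2⟩
    obtain ⟨e1, e2⟩ := proj_eq_of_proj_mem_stratum hs hI h1
    rw [e1, e2] at h2
    exact ⟨h.1 h1, h2⟩
  · rintro ⟨h1, h2⟩
    have h1' := h.2 h1
    obtain ⟨e1, e2⟩ := proj_eq_of_proj_mem_stratum hs hI h1'
    refine ⟨h1', ?_⟩
    rwa [e1, e2]

include hs in
theorem measurableSet_stratumEvent {I : Finset (E d)} (hI : I ⊆ s) (hη : IsBiconic η) :
    MeasurableSet (stratumEvent C s I η) := by
  have h : stratumEvent C s I η = (fun g => ((activeSpace I).starProjection g,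
      (activeSpace I)ᗮ.starProjection g)) ⁻¹' stratumPart C s I η :=
    ext fun g => mem_stratumEvent_iff hs hI
  rw [h]
  exact (by fun_prop : Measurable fun g : E d => ((activeSpace I).starProjection g,
      (activeSpace I)ᗮ.starProjection g)) (isBiconic_stratumPart I hη).1

/-- The projection to `C` lies in exactly one stratum. -/
theorem mem_stratumEvent_iff_activeSet {I : Finset (E d)} (hI : I ⊆ s) {g : E d} :
    g ∈ stratumEvent C s I η ↔
      activeSet s (proj C g) = I ∧ (proj C g, proj (polar C) g) ∈ η :=
  and_congr_left fun _ => (mem_stratum_iff hI).trans (and_iff_right (proj_mem C g))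

theorem activeSet_mem_powerset (s : Finset (E d)) (x : E d) : activeSet s x ∈ s.powerset := by
  classical
  exact Finset.mem_powerset.2 (Finset.filter_subset _ _)

/-- Only the term indexed by the constraints active at Π_C(g) can be nonzero. -/
theorem indicator_eq_sum_stratumEvent (g : E d) :
    η.indicator (fun _ => (1 : ℝ≥0∞)) (proj C g, proj (polar C) g) =
      ∑ I ∈ s.powerset, (stratumEvent C s I η).indicator (fun _ => (1 : ℝ≥0∞)) g := by
  classical
  rw [Finset.sum_eq_single_of_mem (activeSet s (proj C g)) (activeSet_mem_powerset s _)]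
  · simp only [indicator_apply, mem_stratumEvent_iff_activeSet
      (Finset.mem_powerset.1 (activeSet_mem_powerset s (proj C g))), true_and]
  · intro I hI hne
    refine indicator_of_notMem (fun h => hne ?_) _
    exact ((mem_stratumEvent_iff_activeSet (Finset.mem_powerset.1 hI)).1 h).1.symm

include hs in
theorem lintegral_stratumEvent {f : ℝ≥0 × ℝ≥0 → ℝ≥0} (hf : Measurable f) {I : Finset (E d)}
    (hI : I ⊆ s) (hη : IsBiconic η) :
    ∫⁻ g, (f (‖proj C g‖₊ ^ 2, ‖proj (polar C) g‖₊ ^ 2) : ℝ≥0∞) *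
        (stratumEvent C s I η).indicator (fun _ => (1 : ℝ≥0∞)) g ∂stdGaussian (E d) =
      subspaceMean f (activeSpace I) * stdGaussian (E d) (stratumEvent C s I η) := by
  set L := activeSpace I with hL
  have hbi := isBiconic_stratumPart (C := C) (s := s) I hη
  have key := lintegral_norms_mul_indicator_biconic L
    (H := fun p => (f (Real.toNNReal (p.1 ^ 2), Real.toNNReal (p.2 ^ 2)) : ℝ≥0∞))
    (by fun_prop) hbi.1 hbi.2
  simp only [← nnnorm_sq_eq_toNNReal] at key
  have hset : {g | (L.starProjection g, Lᗮ.starProjection g) ∈ stratumPart C s I η} =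
      stratumEvent C s I η := ext fun g => (mem_stratumEvent_iff hs hI).symm
  rw [hset] at key
  rw [subspaceMean, ← key]
  refine lintegral_congr fun g => ?_
  by_cases hg : g ∈ stratumEvent C s I η
  · obtain ⟨e1, e2⟩ := proj_eq_of_proj_mem_stratum hs hI hg.1
    have hg' := (mem_stratumEvent_iff hs hI).1 hg
    rw [indicator_of_mem hg, indicator_of_mem hg', e1, e2]
  · have hg' := (mem_stratumEvent_iff hs hI).not.1 hg
    rw [indicator_of_notMem hg, indicator_of_notMem hg', mul_zero, mul_zero]

include hs in
theorem phi_eq_sum_strata {f : ℝ≥0 × ℝ≥0 → ℝ≥0} (hf : Measurable f) (hη : IsBiconic η) :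
    phi f C η = ∑ I ∈ s.powerset,
      subspaceMean f (activeSpace I) * stdGaussian (E d) (stratumEvent C s I η) := by
  have hm : ∀ I ∈ s.powerset, AEMeasurable (fun g : E d =>
      (f (‖proj C g‖₊ ^ 2, ‖proj (polar C) g‖₊ ^ 2) : ℝ≥0∞) *
        (stratumEvent C s I η).indicator (fun _ => (1 : ℝ≥0∞)) g) (stdGaussian (E d)) := by
    intro I hI
    have hI := Finset.mem_powerset.1 hI
    have hE := measurableSet_stratumEvent hs hI hη
    -- Measurability comes from replacing the nonlinear projections by linear ones, with which they
    -- agree on the event.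
    have heq : (fun g : E d =>
      (f (‖proj C g‖₊ ^ 2, ‖proj (polar C) g‖₊ ^ 2) : ℝ≥0∞) *
        (stratumEvent C s I η).indicator (fun _ => (1 : ℝ≥0∞)) g) = fun g =>
      (f (‖(activeSpace I).starProjection g‖₊ ^ 2,
          ‖(activeSpace I)ᗮ.starProjection g‖₊ ^ 2) : ℝ≥0∞) *
        (stratumEvent C s I η).indicator (fun _ => (1 : ℝ≥0∞)) g := by
      ext g
      by_cases hg : g ∈ stratumEvent C s I η
      · obtain ⟨e1, e2⟩ := proj_eq_of_proj_mem_stratum hs hI hg.1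
        rw [e1, e2]
      · rw [indicator_of_notMem hg, mul_zero, mul_zero]
    rw [heq]
    have : Measurable ((stratumEvent C s I η).indicator (fun _ => (1 : ℝ≥0∞))) :=
      measurable_const.indicator hE
    fun_prop
  rw [phi]
  simp only [indicator_eq_sum_stratumEvent (s := s), Finset.mul_sum]
  rw [lintegral_finsetSum' _ hm]
  exact Finset.sum_congr rfl fun I hI =>
    lintegral_stratumEvent hs hf (Finset.mem_powerset.1 hI) hη

include hs in
-- The k-skeleton is the disjoint union of the strata whose active space has dimension k.
theorem supportMeasure_eq_sum_strata (k : ℕ) (hη : IsBiconic η) :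
    supportMeasure k C η = ∑ I ∈ s.powerset,
      if Module.finrank ℝ (activeSpace I) = k then stdGaussian (E d) (stratumEvent C s I η)
      else 0 := by
  classical
  rw [← Finset.sum_filter, ← measure_biUnion_finset]
  · rw [supportMeasure]
    congr 1
    ext g
    have hact := activeSet_mem_powerset s (proj C g)
    have hsub := Finset.mem_powerset.1 hact
    simp only [mem_ofPred_eq, mem_iUnion, exists_prop]
    constructor
    · rintro ⟨hk, hg⟩
      have hE := (mem_stratumEvent_iff_activeSet (C := C) (η := η) hsub).2 ⟨rfl, hg⟩
      exact ⟨_, Finset.mem_filter.2 ⟨hact, (mem_skel_iff_of_mem_stratum hs hsub hE.1 k).1 hk⟩, hE⟩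
    · rintro ⟨I, hI, hE⟩
      obtain ⟨hI, hk⟩ := Finset.mem_filter.1 hI
      exact ⟨(mem_skel_iff_of_mem_stratum hs (Finset.mem_powerset.1 hI) hE.1 k).2 hk, hE.2⟩
  · intro I hI J hJ hIJ
    have hI' := Finset.mem_powerset.1 (Finset.mem_filter.1 hI).1
    have hJ' := Finset.mem_powerset.1 (Finset.mem_filter.1 hJ).1
    refine disjoint_left.2 fun g hgI hgJ => hIJ ?_
    exact ((mem_stratumEvent_iff_activeSet hI').1 hgI).1.symm.trans
      ((mem_stratumEvent_iff_activeSet hJ').1 hgJ).1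
  · intro I hI
    exact measurableSet_stratumEvent hs (Finset.mem_powerset.1 (Finset.mem_filter.1 hI).1) hη

end Decomposition

end ConicSupport

end

theorem theorem3p1 (d : ℕ) (hd : 2 ≤ d)
    (C : ProperCone ℝ (ConicSupport.E d)) (hC : ConicSupport.IsPolyhedral C)
    (f : ℝ≥0 × ℝ≥0 → ℝ≥0) (hf : Measurable f)
    (hfin : ∀ η : Set (ConicSupport.E d × ConicSupport.E d),
      ConicSupport.IsBiconic η → ConicSupport.phi f C η ≠ ∞) :
    (∀ η : Set (ConicSupport.E d × ConicSupport.E d), ConicSupport.IsBiconic η →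
      ConicSupport.phi f C η =
        ∑ k ∈ Finset.range (d + 1),
          ConicSupport.coeffI d f k * ConicSupport.supportMeasure k C η) ∧
    (∀ k : ℕ, k ≤ d → ∀ L : Submodule ℝ (ConicSupport.E d), Module.finrank ℝ L = k →
      ConicSupport.coeffI d f k = ConicSupport.phi f (ConicSupport.subspaceCone L) univ) := by
  constructor
  · intro η hη
    obtain ⟨s, hs⟩ := hC
    rw [ConicSupport.phi_eq_sum_strata hs hf hη]
    simp only [ConicSupport.supportMeasure_eq_sum_strata hs _ hη, Finset.mul_sum, mul_ite,
      mul_zero]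
    -- Each I contributes to exactly one k, the dimension of its active space, which is at most d.
    rw [Finset.sum_comm]
    refine Finset.sum_congr rfl fun I _ => ?_
    have hle : Module.finrank ℝ (ConicSupport.activeSpace I) < d + 1 :=
      Nat.lt_succ_of_le ((Submodule.finrank_le _).trans finrank_euclideanSpace_fin.le)
    rw [Finset.sum_ite_eq, if_pos (Finset.mem_range.2 hle),
      ConicSupport.subspaceMean_eq_coeffI hd hf]
  · rintro k - L rfl
    rw [ConicSupport.phi_subspaceCone, ConicSupport.subspaceMean_eq_coeffI hd hf]
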